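/- Let $G$ be a connected (finite-dimensional, Hausdorff) Lie group with Lie algebra $\mathfrak g$, and assume that $G$ is unimodular, with Haar measure $\mu$. Let $P\subset G$ be a closed subsemigroup containing the identity which is a Lie semigroup: writing $L(P)=\{X\in\mathfrak g:\exp(tX)\in P\text{ for all }t\ge 0\}$, the semigroup generated by $\exp(L(P))$ is dense in $P$. Assume that the interior of $P$ is dense in $P$ and that $PP^{-1}=P^{-1}P=G$. Let $A\subset G$ be a $P$-space, i.e. a non-empty proper closed subset of $G$ with $PA\subset A$. Let $V=\{V_x\}_{x\in P}$ be the representation of $P$ by isometries on $L^2(A)=L^2(A,\mu)$ given by $$(V_xf)(y)=\begin{cases} f(x^{-1}y) & \text{if } x^{-1}y\in A,\\ 0 & \text{otherwise.}\end{cases}$$ An additive cocycle of $V$ is a continuous map $\xi:P\to L^2(A)$, $x\mapsto \xi_x$, such that $\xi_x\in\ker(V_x^*)$ for all $x\in P$ and $\xi_{xy}=\xi_x+V_x\xi_y$ for all $x,y\in P$. Then: 1. If $\mu(A\setminus xA)<\infty$ for all $x\in P$, then for every $\lambda\in\mathbb C$ the family $\{\lambda 1_{A\setminus xA}\}_{x\in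 P}$ is an additive cocycle of $V$. 2. If $\xi$ is an additive cocycle of $V$, then there is $\lambda\in\mathbb C$ such that $\xi_x=\lambda 1_{A\setminus xA}$ (almost everywhere on $A$) for all $x\in P$. 3. $V$ has a non-zero additive cocycle if and only if $\mu(A\setminus xA)<\infty$ for all $x\in P$. -/

import Mathlib

open MeasureTheory Set Topology
open scoped Manifold ContDiff Pointwise

/-! ### The exponential map of a Lie group and Lie semigroups -/

section LieSemigroup

variable {E : Type*} [NormedAddCommGroup E] [NormedSpace ℝ E] [FiniteDimensional ℝ E]
  {G : Type*} [TopologicalSpace G] [T2Space G] [ChartedSpace E G] [Group G]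
  [LieGroup 𝓘(ℝ, E) ∞ G]

/-- Left-invariant vector fields are complete, and their integral curves are unique: there is
exactly one integral curve, defined for all times, of the left-invariant vector field of `X`
which passes through `1` at time `0`. -/
theorem existsUnique_integralCurve_mulInvariantVectorField (X : GroupLieAlgebra 𝓘(ℝ, E) G) :
    ∃! γ : ℝ → G, γ 0 = 1 ∧ IsMIntegralCurve γ (mulInvariantVectorField (I := 𝓘(ℝ, E)) X) := by
  have hE : CompleteSpace E := FiniteDimensional.complete ℝ E
  have hL : LieGroup 𝓘(ℝ, E) (minSmoothness ℝ 3) G := by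
    refine LieGroup.of_le (n := ∞) ?_
    simp only [minSmoothness_of_isRCLikeNormedField]
    exact WithTop.coe_le_coe.2 (le_top : (3 : ℕ∞) ≤ ⊤)
  have hM : IsManifold 𝓘(ℝ, E) 1 G := IsManifold.of_le (n := ∞) (by exact_mod_cast le_top)
  have hv : ContMDiff 𝓘(ℝ, E) (𝓘(ℝ, E).prod 𝓘(ℝ, E)) 1
      (fun g : G => (⟨g, mulInvariantVectorField (I := 𝓘(ℝ, E)) X g⟩ :
        TangentBundle 𝓘(ℝ, E) G)) := by
    refine (contMDiff_mulInvariantVectorField (I := 𝓘(ℝ, E)) (G := G) X).of_le ?_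
    simp only [minSmoothness_of_isRCLikeNormedField]
    norm_num
  have hm : ∀ a b : G, MDifferentiableAt 𝓘(ℝ, E) 𝓘(ℝ, E) (a * ·) b := fun a b =>
    (contMDiff_mul_left (I := 𝓘(ℝ, E)) (n := ∞) (a := a)).mdifferentiable (by simp) b
  have key : ∃ γ : ℝ → G, γ 0 = 1 ∧
      IsMIntegralCurve γ (mulInvariantVectorField (I := 𝓘(ℝ, E)) X) := by
    obtain ⟨γ, h0, hγ⟩ := exists_isMIntegralCurveAt_of_contMDiffAt_boundaryless
      (I := 𝓘(ℝ, E)) (t₀ := 0) (hv.contMDiffAt (x := (1 : G)))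
    rw [isMIntegralCurveAt_iff'] at hγ
    obtain ⟨ε, hε, hγ⟩ := hγ
    refine exists_isMIntegralCurve_of_isMIntegralCurveOn hv hε (fun g => ?_) 1
    refine ⟨fun t => g * γ t, by simp [h0], ?_⟩
    rw [Real.ball_eq_Ioo] at hγ
    simp only [zero_sub, zero_add] at hγ
    intro t ht
    have h2 := ((hm g (γ t)).hasMFDerivAt).comp_hasMFDerivWithinAt t (hγ t ht)
    have h3 : mfderiv 𝓘(ℝ, E) 𝓘(ℝ, E) ((g * ·) ∘ (γ t * ·)) (1 : G) =
        (mfderiv 𝓘(ℝ, E) 𝓘(ℝ, E) (g * ·) (γ t * 1)).comp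
          (mfderiv 𝓘(ℝ, E) 𝓘(ℝ, E) (γ t * ·) (1 : G)) :=
      mfderiv_comp (1 : G) (hm g (γ t * 1)) (hm (γ t) 1)
    have h4 : ((g * ·) ∘ (γ t * ·) : G → G) = (g * γ t * ·) := by
      ext; simp [mul_assoc]
    rw [h4, mul_one] at h3
    have h5 : mulInvariantVectorField (I := 𝓘(ℝ, E)) X (g * γ t) =
        mfderiv 𝓘(ℝ, E) 𝓘(ℝ, E) (g * ·) (γ t)
          (mulInvariantVectorField (I := 𝓘(ℝ, E)) X (γ t)) := congrArg (fun L => L X) h3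
    refine h2.congr_mfderiv ?_
    refine ContinuousLinearMap.ext_ring ?_
    change _ = (1 : ℝ) • mulInvariantVectorField (I := 𝓘(ℝ, E)) X (g * γ t)
    rw [h5, one_smul]
    exact congrArg (mfderiv 𝓘(ℝ, E) 𝓘(ℝ, E) (g * ·) (γ t)) (one_smul ℝ _)
  obtain ⟨γ, h0, hγ⟩ := key
  refine ⟨γ, ⟨h0, hγ⟩, fun γ' h' => ?_⟩
  exact isMIntegralCurve_Ioo_eq_of_contMDiff_boundaryless (t₀ := 0) hv h'.2 hγ (h'.1.trans h0.symm)

/-- The exponential map `exp : 𝔤 → G` of a Lie group: `exp X = γ 1` for the integral curve `γ`,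
starting at the identity, of the left-invariant vector field of `X`. -/
noncomputable def lieExp (X : GroupLieAlgebra 𝓘(ℝ, E) G) : G :=
  (existsUnique_integralCurve_mulInvariantVectorField X).choose 1

/-- The Lie wedge `L(P) = {X ∈ 𝔤 | exp (t X) ∈ P for all t ≥ 0}`. -/
def lieWedge (E : Type*) [NormedAddCommGroup E] [NormedSpace ℝ E] [FiniteDimensional ℝ E]
    {G : Type*} [TopologicalSpace G] [T2Space G] [ChartedSpace E G] [Group G]
    [LieGroup 𝓘(ℝ, E) ∞ G] (P : Submonoid G) : Set (GroupLieAlgebra 𝓘(ℝ, E) G) :=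
  {X | ∀ t : ℝ, 0 ≤ t → lieExp (t • X) ∈ P}

/-- A Lie semigroup of `G`: a closed subsemigroup `P` containing the identity such that the
semigroup generated by `exp (L(P))` is dense in `P`. -/
structure IsLieSemigroup (E : Type*) [NormedAddCommGroup E] [NormedSpace ℝ E]
    [FiniteDimensional ℝ E] {G : Type*} [TopologicalSpace G] [T2Space G] [ChartedSpace E G]
    [Group G] [LieGroup 𝓘(ℝ, E) ∞ G] (P : Submonoid G) : Prop where
  isClosed : IsClosed (P : Set G)
  dense : (P : Set G) ⊆ closure (Subsemigroup.closure (lieExp '' lieWedge E P) : Set G)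

end LieSemigroup

/-! ### `P`-spaces, the associated isometries, and additive cocycles -/

section PSpace

open Classical in
/-- The translated function `y ↦ f (x⁻¹ y)` if `x⁻¹ y ∈ A`, and `0` otherwise. -/
noncomputable def translateFun {G : Type*} [Group G] (A : Set G) (x : G) (f : G → ℂ) (y : G) : ℂ :=
  if x⁻¹ * y ∈ A then f (x⁻¹ * y) else 0

theorem translateFun_eq_indicator {G : Type*} [Group G] (A : Set G) (x : G) (f : G → ℂ) :
    translateFun A x f = (x • A).indicator (f ∘ (x⁻¹ * ·)) := by
  ext y
  by_cases h : x⁻¹ * y ∈ A <;>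
    simp [translateFun, indicator, mem_smul_set_iff_inv_smul_mem, h]

variable {G : Type*} [TopologicalSpace G] [Group G]

/-- `P` is Ore in `G`: `P P⁻¹ = P⁻¹ P = G`. -/
def IsOre (P : Submonoid G) : Prop :=
  (P : Set G) * (P : Set G)⁻¹ = univ ∧ (P : Set G)⁻¹ * (P : Set G) = univ

/-- A `P`-space: a non-empty proper closed subset `A` of `G` with `P A ⊆ A`. -/
structure IsPSpace (P : Submonoid G) (A : Set G) : Prop where
  nonempty : A.Nonempty
  ne_univ : A ≠ univ
  isClosed : IsClosed A
  mul_mem : ∀ a ∈ P, ∀ x ∈ A, a * x ∈ A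

variable [IsTopologicalGroup G] [MeasurableSpace G] [BorelSpace G]
  {P : Submonoid G} {A : Set G}

theorem measurePreserving_translate (μ : Measure G) [μ.IsMulLeftInvariant]
    (hA : IsPSpace P A) (x : P) :
    MeasurePreserving ((x : G)⁻¹ * ·) (μ.restrict ((x : G) • A)) (μ.restrict A) := by
  have h := (measurePreserving_mul_left μ (x : G)⁻¹).restrict_preimage hA.isClosed.measurableSet
  have e : ((x : G)⁻¹ * ·) ⁻¹' A = (x : G) • A := by
    ext y; simp [mem_smul_set_iff_inv_smul_mem]
  rwa [e] at h

theorem restrict_restrict_smul (μ : Measure G) (hA : IsPSpace P A) (x : P) :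
    (μ.restrict A).restrict ((x : G) • A) = μ.restrict ((x : G) • A) := by
  rw [Measure.restrict_restrict (hA.isClosed.smul (x : G)).measurableSet, inter_eq_left.2]
  rintro _ ⟨a, ha, rfl⟩
  exact hA.mul_mem x x.2 a ha

theorem translateFun_congr (μ : Measure G) [μ.IsMulLeftInvariant] (hA : IsPSpace P A) (x : P)
    {f g : G → ℂ} (h : f =ᵐ[μ.restrict A] g) :
    translateFun A x f =ᵐ[μ.restrict A] translateFun A x g := by
  have h1 : (f ∘ ((x : G)⁻¹ * ·)) =ᵐ[(μ.restrict A).restrict ((x : G) • A)]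
      (g ∘ ((x : G)⁻¹ * ·)) := by
    rw [restrict_restrict_smul μ hA x]
    exact (measurePreserving_translate μ hA x).quasiMeasurePreserving.ae_eq_comp h
  rw [translateFun_eq_indicator, translateFun_eq_indicator]
  rw [Filter.EventuallyEq, ae_restrict_iff' (hA.isClosed.smul (x : G)).measurableSet] at h1
  filter_upwards [h1] with y hy
  by_cases hm : y ∈ (x : G) • A
  · simpa [indicator, hm] using hy hm
  · simp [indicator, hm]

theorem eLpNorm_translateFun (μ : Measure G) [μ.IsMulLeftInvariant] (hA : IsPSpace P A) (x : P)
    {f : G → ℂ} (hf : AEStronglyMeasurable f (μ.restrict A)) :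
    eLpNorm (translateFun A x f) 2 (μ.restrict A) = eLpNorm f 2 (μ.restrict A) := by
  rw [translateFun_eq_indicator, eLpNorm_indicator_eq_eLpNorm_restrict
    (hA.isClosed.smul (x : G)).measurableSet, restrict_restrict_smul μ hA x]
  exact eLpNorm_comp_measurePreserving hf (measurePreserving_translate μ hA x)

theorem memLp_translateFun (μ : Measure G) [μ.IsMulLeftInvariant] (hA : IsPSpace P A) (x : P)
    {f : G → ℂ} (hf : MemLp f 2 (μ.restrict A)) :
    MemLp (translateFun A x f) 2 (μ.restrict A) := by
  rw [translateFun_eq_indicator, memLp_indicator_iff_restrict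
    (hA.isClosed.smul (x : G)).measurableSet, restrict_restrict_smul μ hA x]
  exact hf.comp_measurePreserving (measurePreserving_translate μ hA x)

/-- The isometry `V_x` of `L²(A, μ)` given by `(V_x f)(y) = f (x⁻¹ y)` if `x⁻¹ y ∈ A` and
`(V_x f)(y) = 0` otherwise. -/
noncomputable def pSpaceIsometry (μ : Measure G) [μ.IsMulLeftInvariant] (hA : IsPSpace P A)
    (x : P) : Lp ℂ 2 (μ.restrict A) →ₗᵢ[ℂ] Lp ℂ 2 (μ.restrict A) where
  toFun f := (memLp_translateFun μ hA x (Lp.memLp f)).toLp _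
  map_add' f g := by
    rw [← MemLp.toLp_add]
    refine MemLp.toLp_congr _ _ ((translateFun_congr μ hA x (Lp.coeFn_add f g)).trans ?_)
    refine Filter.Eventually.of_forall fun y => ?_
    by_cases h : (x : G)⁻¹ * y ∈ A <;> simp [translateFun, h]
  map_smul' c f := by
    rw [RingHom.id_apply, ← MemLp.toLp_const_smul]
    refine MemLp.toLp_congr _ _ ((translateFun_congr μ hA x (Lp.coeFn_smul c f)).trans ?_)
    refine Filter.Eventually.of_forall fun y => ?_
    by_cases h : (x : G)⁻¹ * y ∈ A <;> simp [translateFun, h]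
  norm_map' f := by
    change ‖(memLp_translateFun μ hA x (Lp.memLp f)).toLp _‖ = ‖f‖
    rw [Lp.norm_toLp, eLpNorm_translateFun μ hA x (Lp.aestronglyMeasurable f), Lp.norm_def]

theorem coeFn_pSpaceIsometry (μ : Measure G) [μ.IsMulLeftInvariant] (hA : IsPSpace P A)
    (x : P) (f : Lp ℂ 2 (μ.restrict A)) :
    pSpaceIsometry μ hA x f =ᵐ[μ.restrict A] translateFun A x f :=
  MemLp.coeFn_toLp (memLp_translateFun μ hA x (Lp.memLp f))

/-- The representation `x ↦ V_x` of `P` by isometries of `L²(A, μ)` associated to the `P`-space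
`A` (with multiplicity one). -/
noncomputable def pSpaceRep (μ : Measure G) [μ.IsMulLeftInvariant] (hA : IsPSpace P A) :
    P →* (Lp ℂ 2 (μ.restrict A) →ₗᵢ[ℂ] Lp ℂ 2 (μ.restrict A)) where
  toFun := pSpaceIsometry μ hA
  map_one' := by
    refine LinearIsometry.ext fun f => Lp.ext ?_
    refine (coeFn_pSpaceIsometry μ hA 1 f).trans ?_
    filter_upwards [ae_restrict_mem hA.isClosed.measurableSet] with y hy
    simp [translateFun, hy]
  map_mul' x z := by
    refine LinearIsometry.ext fun f => Lp.ext ?_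
    refine (coeFn_pSpaceIsometry μ hA (x * z) f).trans (.symm ?_)
    refine (coeFn_pSpaceIsometry μ hA x _).trans
      ((translateFun_congr μ hA x (coeFn_pSpaceIsometry μ hA z f)).trans ?_)
    refine Filter.Eventually.of_forall fun y => ?_
    have e : ((x * z : P) : G)⁻¹ * y = (z : G)⁻¹ * ((x : G)⁻¹ * y) := by
      simp [mul_assoc]
    by_cases h : (x : G)⁻¹ * y ∈ A
    · simp only [translateFun, h, if_true]
      by_cases h2 : (z : G)⁻¹ * ((x : G)⁻¹ * y) ∈ A
      · rw [if_pos h2, if_pos (e ▸ h2), e]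
      · rw [if_neg h2, if_neg (e ▸ h2)]
    · have h' : (z : G)⁻¹ * ((x : G)⁻¹ * y) ∉ A := fun h' => h <| by
        simpa using hA.mul_mem z z.2 _ h'
      simp only [translateFun]
      rw [if_neg h, if_neg (e ▸ h')]

end PSpace

/-- An additive cocycle of a representation `V` of `P` by isometries of a Hilbert space `H`: a
continuous map `ξ : P → H` such that `ξ_x ∈ Ker (V_x^*)` and `ξ_{xy} = ξ_x + V_x ξ_y`. -/
structure IsAdditiveCocycle {G : Type*} [TopologicalSpace G] [Group G] {P : Submonoid G}
    {H : Type*} [NormedAddCommGroup H] [InnerProductSpace ℂ H] [CompleteSpace H]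
    (V : P →* (H →ₗᵢ[ℂ] H)) (ξ : P → H) : Prop where
  continuous : Continuous ξ
  mem_ker : ∀ x : P, ContinuousLinearMap.adjoint (V x).toContinuousLinearMap (ξ x) = 0
  map_mul : ∀ x y : P, ξ (x * y) = ξ x + V x (ξ y)

/-!
The cocycle identity and the vanishing of `ξ x` on `x • A` say that `ξ (x * p)` agrees with `ξ x` on
`A \ x • A` and with the translate of `ξ p` on `x • A`. Since `P` satisfies both Ore conditions, the
functions `ξ p` on `A \ p • A`, together with all their translates under `G`, therefore agree almost
everywhere on overlaps (`IsAdditiveCocycle.ae_eq_translate`). The sets `q⁻¹ • (A \ p • A)` cover `G`,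
already countably many of them do (`IsPSpace.exists_countable_cover`), so that everything glues to
one measurable function on `G` which is invariant under each left translation up to null sets.
Translations act ergodically (`ae_eq_const_of_forall_mul_left_ae_eq`; this is where right invariance
of the Haar measure enters), hence the function is a constant `c` and `ξ x = c • 1_{A \ x • A}`.

Conversely, the algebraic cocycle properties of `c • 1_{A \ x • A}` are immediate, and continuity
amounts to `μ (A ∆ g • A) → 0` as `g → 1`. This holds as soon as all these measures are finite, by
separability of `L¹(G)` and Steinhaus' theorem (`tendsto_measure_symmDiff_smul`). The cocycle with
`c = 1` is non-zero because otherwise `A` itself would be invariant up to null sets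
(`IsPSpace.exists_measure_diff_ne_zero`).

Of the Lie group structure only the topology matters: a connected locally Euclidean group is
σ-compact, hence second countable.
-/

/-! ### Connected locally compact groups -/

section Topological

/-- A connected group is generated by any compact neighbourhood of the identity, hence it is a
countable union of powers of a compact set. -/
theorem sigmaCompactSpace_of_connected_group {G : Type*} [TopologicalSpace G] [Group G]
    [IsTopologicalGroup G] [LocallyCompactSpace G] [ConnectedSpace G] : SigmaCompactSpace G := by
  obtain ⟨K, hK, hK1⟩ := exists_compact_mem_nhds (1 : G)
  set S : Set G := K ∪ K⁻¹ with hS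
  have hSinv : S⁻¹ = S := by rw [hS, union_inv, inv_inv, union_comm]
  let H : Subgroup G :=
    { carrier := ⋃ n : ℕ, S ^ n
      one_mem' := mem_iUnion.2 ⟨0, by simp⟩
      mul_mem' := by
        intro a b ha hb
        obtain ⟨m, hm⟩ := mem_iUnion.1 ha
        obtain ⟨n, hn⟩ := mem_iUnion.1 hb
        exact mem_iUnion.2 ⟨m + n, by rw [pow_add]; exact mul_mem_mul hm hn⟩
      inv_mem' := by
        intro a ha
        obtain ⟨m, hm⟩ := mem_iUnion.1 ha
        refine mem_iUnion.2 ⟨m, ?_⟩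
        rw [← hSinv, inv_pow]
        exact inv_mem_inv.2 hm }
  have hopen : IsOpen (H : Set G) := H.isOpen_of_mem_nhds (g := 1) <|
    Filter.mem_of_superset hK1 fun k hk => mem_iUnion.2 ⟨1, by simpa [hS] using Or.inl hk⟩
  have huniv : (H : Set G) = univ :=
    IsClopen.eq_univ ⟨H.isClosed_of_isOpen hopen, hopen⟩ ⟨1, H.one_mem⟩
  have hpow : ∀ n : ℕ, IsCompact (S ^ n) := by
    intro n
    induction n with
    | zero => simp
    | succ n ih => rw [pow_succ]; exact ih.mul (hK.union hK.inv)
  exact ⟨⟨fun n => S ^ n, hpow, huniv⟩⟩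

end Topological

/-! ### Gluing, ergodicity and continuity of translations -/

section MeasureTheoretic

/-- Measurable functions which agree almost everywhere on the overlaps of a countable cover can be
glued to a global measurable function. -/
theorem exists_measurable_glue_ae {X β : Type*} [MeasurableSpace X] [MeasurableSpace β]
    {μ : Measure X} {U : ℕ → Set X} {f : ℕ → X → β} (hU : ∀ n, MeasurableSet (U n))
    (hcover : ∀ x, ∃ n, x ∈ U n) (hf : ∀ n, Measurable (f n))
    (hcompat : ∀ m n, ∀ᵐ x ∂μ, x ∈ U m → x ∈ U n → f m x = f n x) :
    ∃ F : X → β, Measurable F ∧ ∀ n, ∀ᵐ x ∂μ, x ∈ U n → F x = f n x := by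
  classical
  refine ⟨fun x => f (Nat.find (hcover x)) x,
    Measurable.find (p := fun n x => x ∈ U n) hf hU hcover, fun n => ?_⟩
  filter_upwards [ae_all_iff.2 fun m => hcompat m n] with x hx hxn
  exact hx _ (Nat.find_spec (hcover x)) hxn

/-- The distance of two translates `x • A`, `y • A` depends on `x⁻¹ * y` only. -/
theorem measure_smul_symmDiff_smul {G : Type*} [Group G] [MeasurableSpace G]
    [MeasurableMul G] (μ : Measure G) [μ.IsMulLeftInvariant]
    (A : Set G) (x y : G) :
    μ (symmDiff (x • A) (y • A)) = μ (symmDiff A ((x⁻¹ * y) • A)) := by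
  have h : symmDiff (x • A) (y • A) = x • symmDiff A ((x⁻¹ * y) • A) := by
    rw [smul_set_symmDiff, smul_smul, mul_inv_cancel_left]
  rw [h, measure_smul]

variable {G : Type*} [Group G] [MeasurableSpace G] [MeasurableMul₂ G]

/-- Ergodicity of the action of a group on itself by translations. By Fubini, almost every orbit
map `g ↦ F (g * y)` is almost everywhere equal to the constant `F y`, and the right translation
`g ↦ g * y` preserves null sets. -/
theorem ae_eq_const_of_forall_mul_left_ae_eq {β : Type*} [MeasurableSpace β] [MeasurableEq β]
    (μ : Measure G) [SFinite μ] [NeZero μ] [μ.IsMulRightInvariant] {F : G → β}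
    (hF : Measurable F) (hinv : ∀ g, ∀ᵐ y ∂μ, F (g * y) = F y) : ∃ c, ∀ᵐ y ∂μ, F y = c := by
  have hm : MeasurableSet {z : G × G | F (z.1 * z.2) = F z.2} :=
    measurableSet_eq_fun (hF.comp measurable_mul) (hF.comp measurable_snd)
  have h := (Measure.ae_ae_comm (μ := μ) (ν := μ) (p := fun g y => F (g * y) = F y) hm).1
    (Filter.Eventually.of_forall hinv)
  obtain ⟨y, hy⟩ := h.exists
  exact ⟨F y, (eventually_mul_right_iff μ y (p := fun g => F g = F y)).1 hy⟩

/-- If all translates of `A` differ from `A` by a set of finite measure, they depend continuously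
on the translating element. The classes of the sets `A ∆ (g • A)` live in the separable space
`L¹(G)`, so that countably many balls cover `G`; one of them has positive measure, and Steinhaus'
theorem applies to it. -/
theorem tendsto_measure_symmDiff_smul [TopologicalSpace G] [IsTopologicalGroup G] [T2Space G]
    [SecondCountableTopology G] [LocallyCompactSpace G] [BorelSpace G]
    (μ : Measure G) [μ.IsHaarMeasure] {A : Set G} (hA : MeasurableSet A)
    (hfin : ∀ g : G, μ (symmDiff A (g • A)) ≠ ⊤) :
    Filter.Tendsto (fun g : G => μ (symmDiff A (g • A))) (𝓝 1) (𝓝 0) := by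
  have hms : ∀ g : G, MeasurableSet (symmDiff A (g • A)) := fun g =>
    hA.symmDiff (hA.const_smul g)
  let v : G → Lp ℝ 1 μ := fun g => indicatorConstLp 1 (hms g) (hfin g) 1
  have hdist : ∀ g h : G, edist (v g) (v h) = μ (symmDiff (g • A) (h • A)) := by
    intro g h
    have he : symmDiff (symmDiff A (g • A)) (symmDiff A (h • A)) = symmDiff (g • A) (h • A) := by
      rw [symmDiff_symmDiff_symmDiff_comm, symmDiff_self, bot_symmDiff]
    have hne : μ (symmDiff (g • A) (h • A)) ≠ ⊤ := by
      rw [measure_smul_symmDiff_smul]; exact hfin _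
    rw [edist_dist, dist_indicatorConstLp_eq_norm,
      norm_indicatorConstLp one_ne_zero ENNReal.one_ne_top]
    simp [he, measureReal_def, ENNReal.ofReal_toReal hne]
  have hmeas : ∀ g : G, Measurable fun h : G => μ (symmDiff (h • A) (g • A)) := by
    intro g
    have hs : MeasurableSet {z : G × G | z.1⁻¹ * z.2 ∈ A} :=
      (measurable_fst.inv.mul measurable_snd) hA
    have ht : MeasurableSet {z : G × G | z.2 ∈ g • A} := measurable_snd (hA.const_smul g)
    have h := measurable_measure_prodMk_left (ν := μ) (hs.symmDiff ht)
    convert h using 4 with x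
    ext y
    simp [Set.mem_symmDiff, mem_smul_set_iff_inv_smul_mem]
  rw [ENNReal.tendsto_nhds_zero]
  intro ε hε
  have hε2 : 0 < ε / 2 := ENNReal.half_pos hε.ne'
  -- countably many balls of radius `ε / 2` cover the group
  obtain ⟨w, hw⟩ : ∃ w : ℕ → G, ∀ g, ∃ n, edist (v g) (v (w n)) < ε / 2 := by
    have : Fact ((1 : ENNReal) ≠ ⊤) := ⟨ENNReal.one_ne_top⟩
    have : Nonempty (range v) := ⟨⟨v 1, 1, rfl⟩⟩
    choose w hw using fun n => (TopologicalSpace.denseSeq (range v) n).2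
    refine ⟨w, fun g => ?_⟩
    obtain ⟨_, ⟨n, rfl⟩, hn⟩ := EMetric.mem_closure_iff.1
      ((TopologicalSpace.denseRange_denseSeq (range v)) ⟨v g, g, rfl⟩) (ε / 2) hε2
    exact ⟨n, by rw [hw n]; exact hn⟩
  let B : ℕ → Set G := fun n => {g | μ (symmDiff (g⁻¹ • A) (w n • A)) < ε / 2}
  have hB : ∀ n, MeasurableSet (B n) := fun n =>
    measurableSet_lt ((hmeas (w n)).comp measurable_inv) measurable_const
  obtain ⟨n, hn⟩ : ∃ n, 0 < μ (B n) := by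
    by_contra! hcon
    have h0 : μ (⋃ n, B n) = 0 := measure_iUnion_null fun n => le_antisymm (hcon n) bot_le
    have hU : ⋃ n, B n = univ := eq_univ_of_forall fun g => by
      obtain ⟨n, hn⟩ := hw g⁻¹
      exact mem_iUnion.2 ⟨n, by rw [hdist] at hn; exact hn⟩
    rw [hU] at h0
    exact NeZero.ne μ (Measure.measure_univ_eq_zero.1 h0)
  let _ := TopologicalSpace.metrizableSpaceMetric G
  filter_upwards [Measure.div_mem_nhds_one_of_haar_pos μ (B n) (hB n) hn] with g hg
  obtain ⟨a, ha, b, hb, rfl⟩ := hg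
  have he : μ (symmDiff A ((a / b) • A)) = edist (v a⁻¹) (v b⁻¹) := by
    rw [hdist, measure_smul_symmDiff_smul, inv_inv, div_eq_mul_inv]
  have ha' : edist (v a⁻¹) (v (w n)) < ε / 2 := by rw [hdist]; exact ha
  have hb' : edist (v b⁻¹) (v (w n)) < ε / 2 := by rw [hdist]; exact hb
  change μ (symmDiff A ((a / b) • A)) ≤ ε
  rw [he, ← ENNReal.add_halves ε]
  exact (edist_triangle_right _ _ (v (w n))).trans (add_le_add ha'.le hb'.le)

end MeasureTheoretic

/-! ### Translates of a `P`-space -/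

section PSpaceGeometry

variable {G : Type*} [Group G] {P : Submonoid G} {A : Set G}

theorem IsOre.exists_inv_mul_eq (h : IsOre P) (g : G) : ∃ r s : P, g = (r : G)⁻¹ * s := by
  have hg : g ∈ (P : Set G)⁻¹ * (P : Set G) := h.2 ▸ mem_univ g
  obtain ⟨a, ha, b, hb, rfl⟩ := hg
  exact ⟨⟨a⁻¹, ha⟩, ⟨b, hb⟩, by simp⟩

/-- The right Ore condition: any two elements of `P` have a common right multiple. -/
theorem IsOre.exists_mul_eq_mul (h : IsOre P) (x y : P) : ∃ p q : P, x * p = y * q := by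
  have hg : (x : G)⁻¹ * y ∈ (P : Set G) * (P : Set G)⁻¹ := h.1 ▸ mem_univ _
  obtain ⟨a, ha, b, hb, hab⟩ := hg
  refine ⟨⟨a, ha⟩, ⟨b⁻¹, hb⟩, Subtype.ext ?_⟩
  change (x : G) * a = y * b⁻¹
  rw [eq_mul_inv_iff_mul_eq, mul_assoc]
  change a * b = _ at hab
  rw [hab, mul_inv_cancel_left]

variable [TopologicalSpace G]

theorem IsPSpace.smul_subset (hA : IsPSpace P A) (x : P) : (x : G) • A ⊆ A := by
  rintro _ ⟨a, ha, rfl⟩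
  exact hA.mul_mem x x.2 a ha

/-- The translates `x • A`, `x ∈ P`, have empty intersection: otherwise `A` would contain a
translate of `P * P⁻¹ = G`. -/
theorem IsPSpace.exists_inv_mul_notMem (hA : IsPSpace P A) (h : IsOre P) (y : G) :
    ∃ x : P, (x : G)⁻¹ * y ∉ A := by
  by_contra! hcon
  refine hA.ne_univ (eq_univ_of_forall fun g => ?_)
  have hg : g * y⁻¹ ∈ (P : Set G) * (P : Set G)⁻¹ := h.1 ▸ mem_univ _
  obtain ⟨a, ha, b, hb, hab⟩ := hg
  have h1 := hA.mul_mem a ha _ (hcon ⟨b⁻¹, hb⟩)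
  change a * b = _ at hab
  rwa [inv_inv, ← mul_assoc, hab, inv_mul_cancel_right] at h1

variable [IsTopologicalGroup G]

theorem IsPSpace.interior_nonempty (hA : IsPSpace P A) (hP : (interior (P : Set G)).Nonempty) :
    (interior A).Nonempty := by
  obtain ⟨p, hp⟩ := hP
  obtain ⟨a, ha⟩ := hA.nonempty
  refine ⟨p * a, interior_maximal ?_ (isOpen_interior.mul_right (t := {a}))
    (mul_mem_mul hp (mem_singleton a))⟩
  rintro _ ⟨x, hx, b, hb, rfl⟩
  rw [mem_singleton_iff.1 hb]
  exact hA.mul_mem x (interior_subset hx) a ha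

/-- The translates `x⁻¹ • interior A`, `x ∈ P`, cover the group. -/
theorem IsPSpace.exists_mul_mem_interior (hA : IsPSpace P A) (h : IsOre P)
    (hint : (interior A).Nonempty) (y : G) : ∃ x : P, (x : G) * y ∈ interior A := by
  obtain ⟨a, ha⟩ := hint
  obtain ⟨r, s, hrs⟩ := h.exists_inv_mul_eq (y * a⁻¹)
  refine ⟨r, ?_⟩
  have hy : (r : G) * y = s * a := by
    rw [mul_inv_eq_iff_eq_mul.1 hrs]; group
  rw [hy]
  refine interior_maximal ?_ (isOpen_interior.smul (s : G)) (smul_mem_smul_set ha)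
  exact (smul_set_mono interior_subset).trans (hA.smul_subset s)

/-- Countably many of the sets `q⁻¹ • (A \ p • A)`, `p, q ∈ P`, cover the group. -/
theorem IsPSpace.exists_countable_cover [SecondCountableTopology G] (hA : IsPSpace P A)
    (h : IsOre P) (hint : (interior A).Nonempty) :
    ∃ p q : ℕ → P, ∀ y, ∃ n, (q n : G) * y ∈ A ∧ (p n : G)⁻¹ * (q n * y) ∉ A := by
  let V : P × P → Set G := fun i =>
    {y | (i.2 : G) * y ∈ interior A} ∩ {y | (i.1 : G)⁻¹ * (i.2 * y) ∈ Aᶜ}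
  have hV : ∀ i, IsOpen (V i) := fun i =>
    (isOpen_interior.preimage (by fun_prop)).inter
      (hA.isClosed.isOpen_compl.preimage (by fun_prop))
  have hcov : ∀ y, ∃ i, y ∈ V i := fun y => by
    obtain ⟨q, hq⟩ := hA.exists_mul_mem_interior h hint y
    obtain ⟨p, hp⟩ := hA.exists_inv_mul_notMem h (q * y)
    exact ⟨(p, q), hq, hp⟩
  obtain ⟨T, hT, hTV⟩ := TopologicalSpace.isOpen_iUnion_countable V hV
  have hcovT : ∀ y, ∃ i ∈ T, y ∈ V i := fun y => by
    have : y ∈ ⋃ i ∈ T, V i := hTV ▸ mem_iUnion.2 (hcov y)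
    simpa only [mem_iUnion, exists_prop] using this
  obtain ⟨i, hi, -⟩ := hcovT 1
  obtain ⟨e, rfl⟩ := hT.exists_eq_range ⟨i, hi⟩
  refine ⟨fun n => (e n).1, fun n => (e n).2, fun y => ?_⟩
  obtain ⟨_, ⟨n, rfl⟩, hn⟩ := hcovT y
  exact ⟨n, interior_subset hn.1, hn.2⟩

end PSpaceGeometry

/-! ### Cocycles as translation invariant functions -/

section Cocycle

variable {G : Type*} [TopologicalSpace G] [Group G] [IsTopologicalGroup G] [MeasurableSpace G]
  [BorelSpace G] {P : Submonoid G} {A : Set G} {μ : Measure G} [μ.IsMulLeftInvariant]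

/-- The functions in the kernel of `V_x^*` vanish on `x • A`: the restriction of such a function
`f` to `x • A` lies in the range of `V_x`, so that it is orthogonal to `f`. -/
theorem ae_eq_zero_of_adjoint_pSpaceRep_eq_zero (hA : IsPSpace P A) (x : P)
    (f : Lp ℂ 2 (μ.restrict A))
    (hf : ContinuousLinearMap.adjoint (pSpaceRep μ hA x).toContinuousLinearMap f = 0) :
    ∀ᵐ y ∂μ, y ∈ A → (x : G)⁻¹ * y ∈ A → f y = 0 := by
  classical
  have hmA := hA.isClosed.measurableSet
  have hpre : ((x : G) * ·) ⁻¹' ((x : G) • A) = A := by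
    ext y; simp [mem_smul_set_iff_inv_smul_mem]
  have hmp : MeasurePreserving ((x : G) * ·) (μ.restrict A) (μ.restrict ((x : G) • A)) := by
    have h := (measurePreserving_mul_left μ (x : G)).restrict_preimage
      (hA.isClosed.smul (x : G)).measurableSet
    rwa [hpre] at h
  have hL : MemLp (f ∘ ((x : G) * ·)) 2 (μ.restrict A) :=
    ((Lp.memLp f).mono_measure (Measure.restrict_mono (hA.smul_subset x)
      le_rfl)).comp_measurePreserving hmp
  set g : Lp ℂ 2 (μ.restrict A) := hL.toLp _ with hg
  have hVg : ∀ᵐ y ∂μ.restrict A, pSpaceRep μ hA x g y = if (x : G)⁻¹ * y ∈ A then f y else 0 := by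
    refine (coeFn_pSpaceIsometry μ hA x g).trans
      ((translateFun_congr μ hA x hL.coeFn_toLp).trans (Filter.Eventually.of_forall fun y => ?_))
    simp [translateFun]
  have horth : inner ℂ (pSpaceRep μ hA x g) f = 0 := by
    have h := ContinuousLinearMap.adjoint_inner_right
      (pSpaceRep μ hA x).toContinuousLinearMap g f
    rw [hf, inner_zero_right] at h
    exact h.symm
  have hself : inner ℂ (pSpaceRep μ hA x g) (pSpaceRep μ hA x g) = 0 := by
    rw [← horth, L2.inner_def, L2.inner_def]
    refine integral_congr_ae ?_
    filter_upwards [hVg] with y hy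
    rw [hy]
    split_ifs <;> simp
  rw [inner_self_eq_zero] at hself
  rw [hself] at hVg
  rw [← ae_restrict_iff' hmA]
  filter_upwards [hVg, Lp.coeFn_zero ℂ 2 (μ.restrict A)] with y hy h0 hxy
  rw [h0, if_pos hxy] at hy
  exact hy.symm

/-- Conversely, functions vanishing on `x • A` lie in the kernel of `V_x^*`. -/
theorem adjoint_pSpaceRep_eq_zero (hA : IsPSpace P A) (x : P) (f : Lp ℂ 2 (μ.restrict A))
    (hf : ∀ᵐ y ∂μ.restrict A, (x : G)⁻¹ * y ∈ A → f y = 0) :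
    ContinuousLinearMap.adjoint (pSpaceRep μ hA x).toContinuousLinearMap f = 0 := by
  refine ext_inner_left ℂ fun g => ?_
  rw [ContinuousLinearMap.adjoint_inner_right, inner_zero_right]
  change inner ℂ (pSpaceRep μ hA x g) f = 0
  rw [L2.inner_def]
  refine integral_eq_zero_of_ae ?_
  filter_upwards [hf, coeFn_pSpaceIsometry μ hA x g] with y hy hg
  change inner ℂ (pSpaceIsometry μ hA x g y) (f y) = 0
  rw [hg, translateFun]
  split_ifs with h
  · rw [hy h, inner_zero_right]
  · rw [inner_zero_left]

variable {ξ : P → Lp ℂ 2 (μ.restrict A)} {hA : IsPSpace P A}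

theorem IsAdditiveCocycle.ae_mul (hξ : IsAdditiveCocycle (pSpaceRep μ hA) ξ) (x p : P) :
    ∀ᵐ y ∂μ, y ∈ A → ξ (x * p) y = ξ x y + translateFun A x (ξ p) y := by
  rw [← ae_restrict_iff' hA.isClosed.measurableSet, hξ.map_mul]
  filter_upwards [Lp.coeFn_add (ξ x) (pSpaceRep μ hA x (ξ p)),
    coeFn_pSpaceIsometry μ hA x (ξ p)] with y h1 h2
  rw [h1, Pi.add_apply, ← h2]
  rfl

theorem IsAdditiveCocycle.ae_mul_apply_mul (hξ : IsAdditiveCocycle (pSpaceRep μ hA) ξ) (x p : P) :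
    ∀ᵐ y ∂μ, y ∈ A → ξ (x * p) (x * y) = ξ p y := by
  have h := (hξ.ae_mul x p).and (ae_eq_zero_of_adjoint_pSpaceRep_eq_zero hA x _ (hξ.mem_ker x))
  filter_upwards [(eventually_mul_left_iff μ (x : G)).2 h] with y hy hyA
  have hxy := hA.mul_mem x x.2 y hyA
  rw [hy.1 hxy, hy.2 hxy (by simpa using hyA), translateFun]
  simp [hyA]

theorem IsAdditiveCocycle.ae_eq (hξ : IsAdditiveCocycle (pSpaceRep μ hA) ξ) (hOre : IsOre P)
    (x y : P) :
    ∀ᵐ z ∂μ, z ∈ A → (x : G)⁻¹ * z ∉ A → (y : G)⁻¹ * z ∉ A → ξ x z = ξ y z := by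
  obtain ⟨p, q, hpq⟩ := hOre.exists_mul_eq_mul x y
  filter_upwards [hξ.ae_mul x p, hξ.ae_mul y q] with z hx hy hz hxz hyz
  have h := hx hz
  rw [hpq, hy hz] at h
  simpa [translateFun, hxz, hyz] using h.symm

/-- The values of a cocycle are restrictions of a single function which is invariant under the
whole group: wherever `ξ p z` and `ξ p' (g * z)` are not forced to vanish, they coincide. -/
theorem IsAdditiveCocycle.ae_eq_translate (hξ : IsAdditiveCocycle (pSpaceRep μ hA) ξ)
    (hOre : IsOre P) (p p' : P) (g : G) :
    ∀ᵐ z ∂μ, z ∈ A → (p : G)⁻¹ * z ∉ A → g * z ∈ A → (p' : G)⁻¹ * (g * z) ∉ A →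
      ξ p' (g * z) = ξ p z := by
  obtain ⟨r', r, rfl⟩ := hOre.exists_inv_mul_eq g
  filter_upwards [hξ.ae_mul_apply_mul r p,
    (eventually_mul_left_iff μ ((r' : G)⁻¹ * r)).2 (hξ.ae_mul_apply_mul r' p'),
    (eventually_mul_left_iff μ (r : G)).2 (hξ.ae_eq hOre (r * p) (r' * p'))]
    with z h1 h2 h3 hz hpz hgz hpgz
  rw [← h1 hz, ← h2 hgz]
  have e : (r' : G) * ((r' : G)⁻¹ * r * z) = r * z := by group
  rw [e]
  refine (h3 (hA.mul_mem r r.2 z hz) ?_ ?_).symm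
  · simpa [mul_assoc] using hpz
  · simpa [mul_assoc] using hpgz

end Cocycle

/-! ### Classification of the additive cocycles -/

section Classification

variable {G : Type*} [TopologicalSpace G] [Group G] [IsTopologicalGroup G]
  [SecondCountableTopology G] [MeasurableSpace G] [BorelSpace G]
  {P : Submonoid G} {A : Set G} {μ : Measure G}

/-- The pieces `ξ p (q * ·)` of a cocycle on the sets `q⁻¹ • (A \ p • A)` glue to a function on `G`
which is invariant under all left translations, hence constant. -/
theorem IsAdditiveCocycle.exists_const [SigmaFinite μ] [NeZero μ] [μ.IsMulLeftInvariant]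
    [μ.IsMulRightInvariant] {hA : IsPSpace P A} {ξ : P → Lp ℂ 2 (μ.restrict A)}
    (hξ : IsAdditiveCocycle (pSpaceRep μ hA) ξ) (hOre : IsOre P) (hint : (interior A).Nonempty) :
    ∃ c : ℂ, ∀ x : P, ξ x =ᵐ[μ.restrict A] (A \ (x : G) • A).indicator fun _ => c := by
  obtain ⟨p, q, hpq⟩ := hA.exists_countable_cover hOre hint
  have hmA := hA.isClosed.measurableSet
  have hmeas : ∀ x : P, Measurable (ξ x) := fun x => (Lp.stronglyMeasurable _).measurable
  let U : ℕ → Set G := fun n => {y | (q n : G) * y ∈ A ∧ (p n : G)⁻¹ * (q n * y) ∉ A}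
  have hU : ∀ n, MeasurableSet (U n) := fun n =>
    (measurable_const_mul (q n : G) hmA).inter
      (((measurable_const_mul (p n : G)⁻¹).comp (measurable_const_mul (q n : G))) hmA.compl)
  -- the pieces agree almost everywhere, up to any left translation `g`
  have key : ∀ (g : G) (m n : ℕ), ∀ᵐ y ∂μ, y ∈ U m → g * y ∈ U n →
      ξ (p n) (q n * (g * y)) = ξ (p m) (q m * y) := by
    intro g m n
    filter_upwards [(eventually_mul_left_iff μ (q m : G)).2
      (hξ.ae_eq_translate hOre (p m) (p n) (q n * g * (q m : G)⁻¹))] with y hy hm hn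
    have e : (q n : G) * g * (q m : G)⁻¹ * (q m * y) = q n * (g * y) := by group
    rw [e] at hy
    exact hy hm.1 hm.2 hn.1 hn.2
  obtain ⟨F, hF, hFξ⟩ := exists_measurable_glue_ae (μ := μ) (f := fun n y => ξ (p n) (q n * y))
    hU hpq (fun n => (hmeas _).comp (measurable_const_mul _)) (fun m n => by
      filter_upwards [key 1 m n] with y hy hm hn
      simpa using (hy hm (by simpa using hn)).symm)
  obtain ⟨c, hc⟩ := ae_eq_const_of_forall_mul_left_ae_eq μ hF fun g => by
    filter_upwards [ae_all_iff.2 hFξ, (eventually_mul_left_iff μ g).2 (ae_all_iff.2 hFξ),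
      ae_all_iff.2 fun m => ae_all_iff.2 fun n => key g m n] with y h1 h2 h3
    obtain ⟨m, hm⟩ := hpq y
    obtain ⟨n, hn⟩ := hpq (g * y)
    rw [h1 m hm, h2 n hn, h3 m n hm hn]
  refine ⟨c, fun x => ?_⟩
  rw [Filter.EventuallyEq, ae_restrict_iff' hmA]
  filter_upwards [hc, ae_all_iff.2 hFξ,
    ae_eq_zero_of_adjoint_pSpaceRep_eq_zero hA x _ (hξ.mem_ker x),
    ae_all_iff.2 fun n => hξ.ae_eq_translate hOre x (p n) (q n)] with y h1 h2 h3 h4 hy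
  by_cases hxy : (x : G)⁻¹ * y ∈ A
  · rw [h3 hy hxy, indicator_of_notMem]
    exact fun h => h.2 (mem_smul_set_iff_inv_smul_mem.2 hxy)
  · obtain ⟨n, hn⟩ := hpq y
    have hyx : y ∈ A \ (x : G) • A := ⟨hy, fun h => hxy (mem_smul_set_iff_inv_smul_mem.1 h)⟩
    rw [indicator_of_mem hyx, ← h1, h2 n hn, h4 n hy hxy hn.1 hn.2]

/-- If all sets `A \ x • A` were null, then `A` would be invariant under `G` up to null sets,
hence null or conull by ergodicity; a closed set with interior points is neither, unless it is
the whole group. -/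
theorem IsPSpace.exists_measure_diff_ne_zero [SigmaFinite μ] [μ.IsOpenPosMeasure]
    [μ.IsMulLeftInvariant] [μ.IsMulRightInvariant] (hA : IsPSpace P A) (hOre : IsOre P)
    (hint : (interior A).Nonempty) : ∃ x : P, μ (A \ (x : G) • A) ≠ 0 := by
  by_contra! hcon
  have hmA := hA.isClosed.measurableSet
  have hP : ∀ x : P, ∀ᵐ y ∂μ, (x : G) * y ∈ A ↔ y ∈ A := by
    intro x
    filter_upwards [(eventually_mul_left_iff μ (x : G)).2 (measure_eq_zero_iff_ae_notMem.1 (hcon x))]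
      with y hy
    refine ⟨fun h => ?_, hA.mul_mem x x.2 y⟩
    by_contra hyA
    exact hy ⟨h, fun h' => hyA (by simpa [mem_smul_set_iff_inv_smul_mem] using h')⟩
  obtain ⟨c, hc⟩ := ae_eq_const_of_forall_mul_left_ae_eq μ
    (F := A.indicator fun _ => (1 : ℝ)) (measurable_const.indicator hmA) fun g => by
      obtain ⟨r, s, rfl⟩ := hOre.exists_inv_mul_eq g
      filter_upwards [hP s, (eventually_mul_left_iff μ ((r : G)⁻¹ * s)).2 (hP r)] with y h1 h2
      have e : (r : G) * ((r : G)⁻¹ * s * y) = s * y := by group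
      rw [e, h1] at h2
      by_cases h : y ∈ A
      · rw [indicator_of_mem h, indicator_of_mem (h2.1 h)]
      · rw [indicator_of_notMem h, indicator_of_notMem (mt h2.2 h)]
  have hpos : ∃ᵐ y ∂μ, y ∈ interior A := by
    rw [frequently_ae_mem_iff]
    exact (isOpen_interior.measure_pos μ hint).ne'
  obtain ⟨y, hy, hyc⟩ := (hpos.and_eventually hc).exists
  rw [indicator_of_mem (interior_subset hy)] at hyc
  subst hyc
  have hcompl : μ Aᶜ = 0 := by
    rw [measure_eq_zero_iff_ae_notMem]
    filter_upwards [hc] with z hz hzA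
    rw [indicator_of_notMem hzA] at hz
    exact zero_ne_one hz
  have hempty := hA.isClosed.isOpen_compl.eq_empty_of_measure_zero hcompl
  exact hA.ne_univ (compl_empty_iff.1 hempty)

/-- The family `c • 1_{A \ x • A}` is an additive cocycle as soon as these functions are square
integrable. Its continuity is that of `g ↦ μ (A ∆ g • A)` at the identity. -/
theorem IsPSpace.exists_isAdditiveCocycle [T2Space G] [LocallyCompactSpace G] [μ.IsHaarMeasure]
    (hA : IsPSpace P A) (hOre : IsOre P) (hfin : ∀ x : P, μ (A \ (x : G) • A) < ⊤) (c : ℂ) :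
    ∃ ξ : P → Lp ℂ 2 (μ.restrict A), IsAdditiveCocycle (pSpaceRep μ hA) ξ ∧
      ∀ x : P, ξ x =ᵐ[μ.restrict A] (A \ (x : G) • A).indicator fun _ => c := by
  have hmA := hA.isClosed.measurableSet
  have hms : ∀ x : P, MeasurableSet (A \ (x : G) • A) := fun x =>
    hmA.diff (hmA.const_smul (x : G))
  have hres : ∀ x : P, μ.restrict A (A \ (x : G) • A) ≠ ⊤ := fun x =>
    ((Measure.restrict_apply_le _ _).trans_lt (hfin x)).ne
  have hsymm : ∀ x y : P, symmDiff (A \ (x : G) • A) (A \ (y : G) • A) =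
      symmDiff ((x : G) • A) ((y : G) • A) := by
    intro x y
    ext z
    have h1 := @hA.smul_subset _ _ _ _ _ x z
    have h2 := @hA.smul_subset _ _ _ _ _ y z
    simp only [mem_symmDiff, mem_sdiff]
    tauto
  have hG : ∀ g : G, μ (symmDiff A (g • A)) ≠ ⊤ := by
    intro g
    obtain ⟨r, s, rfl⟩ := hOre.exists_inv_mul_eq g
    rw [← measure_smul_symmDiff_smul, ← hsymm]
    refine ((measure_mono symmDiff_subset_union).trans_lt ?_).ne
    exact (measure_union_le _ _).trans_lt (ENNReal.add_lt_top.2 ⟨hfin r, hfin s⟩)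
  have hlim := tendsto_measure_symmDiff_smul μ hmA hG
  have hcoe : ∀ x : P, indicatorConstLp 2 (hms x) (hres x) c =ᵐ[μ.restrict A]
      (A \ (x : G) • A).indicator fun _ => c := fun x => indicatorConstLp_coeFn
  refine ⟨fun x => indicatorConstLp 2 (hms x) (hres x) c, ⟨?_, fun x => ?_, fun x y => ?_⟩, hcoe⟩
  · refine continuous_indicatorConstLp_set ENNReal.ofNat_ne_top fun x => ?_
    have hx : Filter.Tendsto (fun y : P => (x : G)⁻¹ * y) (𝓝 x) (𝓝 1) := by
      have h : Continuous fun y : P => (x : G)⁻¹ * y := by fun_prop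
      simpa using h.tendsto x
    refine tendsto_of_tendsto_of_tendsto_of_le_of_le tendsto_const_nhds (hlim.comp hx)
      (fun _ => bot_le) fun y => (Measure.restrict_apply_le _ _).trans ?_
    rw [symmDiff_comm, hsymm, measure_smul_symmDiff_smul]
    rfl
  · refine adjoint_pSpaceRep_eq_zero hA x _ ?_
    filter_upwards [hcoe x] with y hy hxy
    rw [hy, indicator_of_notMem]
    exact fun h => h.2 (mem_smul_set_iff_inv_smul_mem.2 hxy)
  · refine Lp.ext ?_
    filter_upwards [hcoe (x * y), Lp.coeFn_add (indicatorConstLp 2 (hms x) (hres x) c)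
      (pSpaceRep μ hA x (indicatorConstLp 2 (hms y) (hres y) c)), hcoe x,
      (coeFn_pSpaceIsometry μ hA x _).trans (translateFun_congr μ hA x (hcoe y)),
      ae_restrict_mem hmA] with z h1 h2 h3 h4 hz
    change pSpaceRep μ hA x (indicatorConstLp 2 (hms y) (hres y) c) z = _ at h4
    rw [h1, h2, Pi.add_apply, h3, h4, translateFun]
    have e : ((x * y : P) : G)⁻¹ * z = (y : G)⁻¹ * ((x : G)⁻¹ * z) := by simp [mul_assoc]
    have hyA : (y : G)⁻¹ * ((x : G)⁻¹ * z) ∈ A → (x : G)⁻¹ * z ∈ A := fun h => by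
      simpa using hA.mul_mem y y.2 _ h
    have hmem : ∀ g w : G, w ∈ A \ g • A ↔ w ∈ A ∧ g⁻¹ * w ∉ A := fun g w => by
      rw [mem_sdiff, mem_smul_set_iff_inv_smul_mem, smul_eq_mul]
    classical
    simp only [indicator_apply, hmem, e, hz, true_and]
    by_cases h : (x : G)⁻¹ * z ∈ A
    · simp [h]
    · simp [h, mt hyA h]

end Classification

theorem mainTheorem5
    {E : Type*} [NormedAddCommGroup E] [NormedSpace ℝ E] [FiniteDimensional ℝ E]
    {G : Type*} [TopologicalSpace G] [T2Space G] [ConnectedSpace G] [ChartedSpace E G] [Group G]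
    [LieGroup 𝓘(ℝ, E) ∞ G] [IsTopologicalGroup G] [MeasurableSpace G] [BorelSpace G]
    (μ : Measure G) [μ.IsHaarMeasure] [μ.IsMulRightInvariant]
    (P : Submonoid G) (hP : IsLieSemigroup E P)
    (hPint : (P : Set G) ⊆ closure (interior (P : Set G))) (hOre : IsOre P)
    (A : Set G) (hA : IsPSpace P A) :
    ((∀ x : P, μ (A \ (x : G) • A) < ⊤) → ∀ c : ℂ,
      ∃ ξ : P → Lp ℂ 2 (μ.restrict A), IsAdditiveCocycle (pSpaceRep μ hA) ξ ∧
        ∀ x : P, ξ x =ᵐ[μ.restrict A] (A \ (x : G) • A).indicator fun _ => c) ∧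
    (∀ ξ : P → Lp ℂ 2 (μ.restrict A), IsAdditiveCocycle (pSpaceRep μ hA) ξ →
      ∃ c : ℂ, ∀ x : P, ξ x =ᵐ[μ.restrict A] (A \ (x : G) • A).indicator fun _ => c) ∧
    ((∃ ξ : P → Lp ℂ 2 (μ.restrict A), IsAdditiveCocycle (pSpaceRep μ hA) ξ ∧ ξ ≠ 0) ↔
      ∀ x : P, μ (A \ (x : G) • A) < ⊤) := by
  have : ProperSpace E := FiniteDimensional.proper ℝ E
  have : LocallyCompactSpace G := ChartedSpace.locallyCompactSpace E G
  have : SigmaCompactSpace G := sigmaCompactSpace_of_connected_group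
  have : SecondCountableTopology G := ChartedSpace.secondCountable_of_sigmaCompact E G
  have hmA := hA.isClosed.measurableSet
  have hint : (interior A).Nonempty :=
    hA.interior_nonempty (closure_nonempty_iff.1 ⟨1, hPint P.one_mem⟩)
  refine ⟨fun hfin c => hA.exists_isAdditiveCocycle hOre hfin c,
    fun ξ hξ => hξ.exists_const hOre hint, ?_, fun hfin => ?_⟩
  · rintro ⟨ξ, hξ, hne⟩ x
    obtain ⟨c, hc⟩ := hξ.exists_const hOre hint
    have hc0 : c ≠ 0 := by
      rintro rfl
      refine hne (funext fun y => Lp.ext ((hc y).trans ?_))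
      rw [indicator_zero]
      exact (Lp.coeFn_zero ℂ 2 (μ.restrict A)).symm
    have hms : MeasurableSet (A \ (x : G) • A) := hmA.diff (hmA.const_smul (x : G))
    -- Chebyshev's inequality for `ξ x`, whose modulus is `‖c‖` on `A \ x • A`
    have hL := ((memLp_congr_ae (hc x)).1 (Lp.memLp (ξ x))).meas_ge_lt_top two_ne_zero
      ENNReal.ofNat_ne_top (nnnorm_ne_zero_iff.2 hc0)
    refine lt_of_le_of_lt ?_ hL
    rw [← Measure.restrict_eq_self μ (sdiff_subset (s := A) (t := (x : G) • A))]
    refine measure_mono fun y hy => ?_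
    rw [mem_ofPred_eq, indicator_of_mem hy]
  · obtain ⟨x, hx⟩ := hA.exists_measure_diff_ne_zero (μ := μ) hOre hint
    obtain ⟨ξ, hξ, hξ1⟩ := hA.exists_isAdditiveCocycle hOre hfin 1
    refine ⟨ξ, hξ, ?_⟩
    rintro rfl
    have h0 := (Lp.coeFn_zero ℂ 2 (μ.restrict A)).symm.trans (hξ1 x)
    rw [Filter.EventuallyEq, ae_restrict_iff' hmA] at h0
    refine hx (measure_eq_zero_iff_ae_notMem.2 ?_)
    filter_upwards [h0] with y hy hyx
    simpa [hyx] using hy hyx.1
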